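/- Let $q$ be a power of an odd prime $p$, let $\mathrm{Tr}$ denote the trace from $\mathbb F_{q^4}$ to $\mathbb F_q$, let $\eta_1$ be the quadratic character of $\mathbb F_q$ (with $\eta_1(0)=0$), and let $m_p\in\mathbb F_p$ be the residue of $m=4$ modulo $p$. For a positive integer $e$ with $4/\gcd(4,e)$ even, put $\epsilon=0$ if $2/\gcd(4,e)$ is odd and $\epsilon=\gcd(4,e)$ if $2/\gcd(4,e)$ is even, and assume $\epsilon=1$ (that is, $e$ is odd). Let $u,v\in\mathbb F_q$ with $v\neq 0$, let $$D_1=\{x\in\mathbb F_{q^4}^*:\ \mathrm{Tr}(x^{q^e+1})=u,\ \mathrm{Tr}(x)=v\}=\{d_1,\dots,d_n\},$$ and let $\mathcal C_{D_1}=\{(\mathrm{Tr}(bd_1),\dots,\mathrm{Tr}(bd_n)) : b\in\mathbb F_{q^4}\}$. An $[n,k,d]$ linear code over $\mathbb F_q$ is a $k$-dimensional subspace of $\mathbb F_q^n$ with minimum Hamming distance $d$; its weight enumerator is $1+A_1z+\dots+A_nz^n$, where $A_i$ is the number of codewords of Hamming weight $i$; it is a $t$-weight code if exactly $t$ of $A_1,\dots,A_n$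 are nonzero; it meets the Griesmer bound if $n=\sum_{i=0}^{k-1}\lceil d/q^i\rceil$; and it is optimal if every $[n',k',d']$ linear code over $\mathbb F_q$ with $n'\le n$, $k'\ge k$, $d'\ge d$ has $(n',k',d')=(n,k,d)$. 1) If $v^2-um_p\neq 0$ and $\eta_1(v^2-um_p)=-1$, then $\mathcal C_{D_1}$ is a $3$-weight $[2q^2,4,q^2]$ linear code over $\mathbb F_q$ with weight enumerator $$1+2(q-1)z^{q^2}+(q^4-q^2)z^{2q(q-1)}+(q-1)^2z^{2q^2}.$$ 2) If $v^2-um_p=0$, then $\mathcal C_{D_1}$ is a $2$-weight $[q^2,3,q^2-q]$ linear code over $\mathbb F_q$ that is optimal and meets the Griesmer bound, with weight enumerator $$1+(q^3-q)z^{(q-1)q}+(q-1)z^{q^2}.$$ -/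

import Mathlib

open Polynomial

namespace FewWeightCodes

section Codes

variable {F : Type*} [Field F] [DecidableEq F] {ι : Type*} [Fintype ι]

/-- `C` is an `[n, k, d]` linear code: its length is `n`, its dimension over `F` is `k`, and its
minimum Hamming distance (between distinct codewords, at least one such pair existing) is `d`.
Codes are subspaces of `ι → F`, the coordinates being indexed by a finite type `ι`. -/
def IsLinearCode (C : Submodule F (ι → F)) (n k d : ℕ) : Prop :=
  Fintype.card ι = n ∧ Module.finrank F C = k ∧
    IsLeast {w : ℕ | ∃ x ∈ C, ∃ y ∈ C, x ≠ y ∧ hammingDist x y = w} d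

/-- The number `A_i` of codewords of Hamming weight `i`. -/
noncomputable def weightCount (C : Submodule F (ι → F)) (i : ℕ) : ℕ :=
  Set.ncard {c : ι → F | c ∈ C ∧ hammingNorm c = i}

/-- The weight enumerator `1 + A_1 z + ⋯ + A_n z ^ n` of a code of length `n`. -/
noncomputable def weightEnumerator (C : Submodule F (ι → F)) : ℤ[X] :=
  1 + ∑ i ∈ Finset.Icc 1 (Fintype.card ι), (weightCount C i : ℤ[X]) * X ^ i

/-- A `t`-weight code: exactly `t` of the numbers `A_1, …, A_n` are nonzero. -/
def IsWeightCode (C : Submodule F (ι → F)) (t : ℕ) : Prop :=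
  Finset.card {i ∈ Finset.Icc 1 (Fintype.card ι) | weightCount C i ≠ 0} = t

variable (F) in
/-- The parameters `n, k, d` meet the Griesmer bound over `F` with equality:
`n = ∑_{i < k} ⌈d / q ^ i⌉`, where `q = |F|`. -/
def MeetsGriesmerBound [Fintype F] (n k d : ℕ) : Prop :=
  n = ∑ i ∈ Finset.range k, ⌈(d : ℚ) / (Fintype.card F : ℚ) ^ i⌉₊

/-- `C` is an optimal `[n, k, d]` linear code: no linear code over `F` has parameters that are at
least as good in all of length, dimension and minimum distance, and better in one of them. -/
def IsOptimalLinearCode (C : Submodule F (ι → F)) (n k d : ℕ) : Prop :=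
  IsLinearCode C n k d ∧
    ∀ (n' k' d' : ℕ) (C' : Submodule F (Fin n' → F)), IsLinearCode C' n' k' d' →
      n' ≤ n → k ≤ k' → d ≤ d' → n' = n ∧ k' = k ∧ d' = d

end Codes

section TraceCodes

variable (F : Type*) {K : Type*} [Field F] [Field K] [Algebra F K]

/-- The code `C_D = {(Tr (b d))_{d ∈ D} : b ∈ K}` with defining set `D ⊆ K`. -/
noncomputable def traceCode (D : Finset K) : Submodule F (D → F) :=
  LinearMap.range
    (LinearMap.pi fun d : D => (Algebra.trace F K).comp (LinearMap.mulRight F (d : K)))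

variable {F} in
theorem mem_traceCode {D : Finset K} {c : D → F} :
    c ∈ traceCode F D ↔ ∃ b : K, c = fun d : D => Algebra.trace F K (b * (d : K)) := by
  constructor
  · rintro ⟨b, rfl⟩
    exact ⟨b, rfl⟩
  · rintro ⟨b, rfl⟩
    exact ⟨b, rfl⟩

variable {F} in
/-- `D_1 = {x ∈ K^* : Tr (x ^ (q ^ e + 1)) = u, Tr x = v}`, where `q = |F|`. -/
noncomputable def definingSet₁ (K : Type*) [Field K] [Algebra F K] [Fintype F] [DecidableEq F]
    [Fintype K] [DecidableEq K] (e : ℕ) (u v : F) : Finset K :=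
  {x : K | x ≠ 0 ∧ Algebra.trace F K (x ^ (Fintype.card F ^ e + 1)) = u ∧
    Algebra.trace F K x = v}

end TraceCodes

/-- For even `m = 2 ℓ` with `m / gcd (m, e)` even, `ε` is `0` if `ℓ / gcd (m, e)` is odd and
`gcd (m, e)` if it is even. -/
def eps (m e : ℕ) : ℕ :=
  if Odd ((m / 2) / Nat.gcd m e) then 0 else Nat.gcd m e

/-- The residue `m_p = m mod p`, as an element of the field `F` of characteristic `p`. -/
def residue (F : Type*) [Field F] (p m : ℕ) : F := ((m % p : ℕ) : F)

end FewWeightCodes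

/-! Let σ be the `q`-Frobenius of `K` over `F`, so σ⁴ = 1, and put z = x + σ²x. Then Tr(x) = z + σz,
and for odd e also Tr(x^(q^e+1)) = z·σz. So x lies in D₁ exactly when z and σz are the roots of T² -
vT + u, whose discriminant is v² - 4u. If that is a nonsquare, it has a root t in `K` with σt = -t,
and z = (v ± t)/2; if it is zero, z = v/2. Hence D₁ is a union of r = 2 or r = 1 cosets of the plane
ker(σ² + 1), with representatives z/2 in ker(σ² - 1), independent over `F` (`mem_definingSet₁_iff`).

Nondegeneracy of the trace form makes the values of x ↦ Tr(bx) on the representatives and on a basis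
of the plane arbitrary. The code is therefore that of r affine functions on F² with a common linear
part and free constants (`exists_equiv_traceCode`). A nonzero linear part gives weight r·q(q-1); a
zero one gives q² times the number of nonzero constants. Dimension, minimum distance and enumerator
follow for every r at once.

Optimality for r = 1 comes from the Plotkin averaging bound, applied to the code and, to exclude
larger dimension, to the subcode vanishing at one coordinate (`parameters_eq_of_isLinearCode`). -/

namespace FewWeightCodes

/-! ### Codes as injective images of a parameter space -/

section Parametrized

variable {F : Type*} [Field F] [DecidableEq F] {ι : Type*} [Fintype ι]
  {P : Type*} [AddCommGroup P] [Module F P]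

theorem weightCount_range [Fintype P] (Φ : P →ₗ[F] ι → F) (hΦ : Function.Injective Φ) (i : ℕ) :
    weightCount (LinearMap.range Φ) i =
      Finset.card {p : P | hammingNorm (Φ p) = i} := by
  classical
  unfold weightCount
  have h : {c : ι → F | c ∈ LinearMap.range Φ ∧ hammingNorm c = i} =
      ((({p : P | hammingNorm (Φ p) = i} : Finset P).image Φ : Finset (ι → F)) :
        Set (ι → F)) := by
    ext c
    simp only [Set.mem_ofPred_eq, LinearMap.mem_range, Finset.coe_image, Set.mem_image,
      Finset.coe_filter, Finset.mem_univ, true_and]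
    constructor
    · rintro ⟨⟨p, rfl⟩, h⟩
      exact ⟨p, h, rfl⟩
    · rintro ⟨p, h, rfl⟩
      exact ⟨⟨p, rfl⟩, h⟩
  rw [h, Set.ncard_coe_finset, Finset.card_image_of_injective _ hΦ]

/-- Grouping the parameters by weight gives the coefficients; by injectivity only the zero parameter
has weight 0, which is the leading 1. -/
theorem weightEnumerator_range [Fintype P] (Φ : P →ₗ[F] ι → F) (hΦ : Function.Injective Φ) :
    weightEnumerator (LinearMap.range Φ) = ∑ p : P, (X : ℤ[X]) ^ hammingNorm (Φ p) := by
  classical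
  have h0 : weightCount (LinearMap.range Φ) 0 = 1 := by
    rw [weightCount_range Φ hΦ, Finset.card_eq_one]
    refine ⟨0, ?_⟩
    ext p
    simp [map_eq_zero_iff Φ hΦ]
  have hsum : ∑ p : P, (X : ℤ[X]) ^ hammingNorm (Φ p) =
      ∑ i ∈ Finset.range (Fintype.card ι + 1),
        (weightCount (LinearMap.range Φ) i : ℤ[X]) * X ^ i := by
    rw [← Finset.sum_fiberwise_of_maps_to (s := Finset.univ)
      (t := Finset.range (Fintype.card ι + 1)) (g := fun p : P => hammingNorm (Φ p))
      (fun p _ => Finset.mem_range.2 (Nat.lt_succ_of_le hammingNorm_le_card_fintype))]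
    refine Finset.sum_congr rfl fun i _ => ?_
    rw [weightCount_range Φ hΦ, Finset.sum_congr rfl (g := fun _ => (X : ℤ[X]) ^ i)]
    · rw [Finset.sum_const, nsmul_eq_mul]
    · intro p hp
      rw [(Finset.mem_filter.1 hp).2]
  rw [hsum, Finset.sum_range_succ', h0, weightEnumerator, add_comm]
  congr 1
  · rw [Finset.range_eq_Ico, Finset.sum_Ico_add'
      (fun i => (weightCount (LinearMap.range Φ) i : ℤ[X]) * X ^ i) 0 (Fintype.card ι) 1]
    rfl
  · simp

theorem isLinearCode_range (Φ : P →ₗ[F] ι → F) (hΦ : Function.Injective Φ) {n k d : ℕ}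
    (hn : Fintype.card ι = n) (hk : Module.finrank F P = k)
    (hle : ∀ p : P, p ≠ 0 → d ≤ hammingNorm (Φ p))
    (hex : ∃ p : P, p ≠ 0 ∧ hammingNorm (Φ p) = d) :
    IsLinearCode (LinearMap.range Φ) n k d := by
  refine ⟨hn, by rw [LinearMap.finrank_range_of_inj hΦ, hk], ?_, ?_⟩
  · obtain ⟨p, hp, h⟩ := hex
    refine ⟨Φ p, ⟨p, rfl⟩, 0, zero_mem _, ?_, by rw [hammingDist_zero_right, h]⟩
    rwa [Ne, map_eq_zero_iff Φ hΦ]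
  · rintro w ⟨_, ⟨p, rfl⟩, _, ⟨p', rfl⟩, hne, rfl⟩
    rw [hammingDist_eq_hammingNorm, ← map_neg, ← map_add]
    exact hle _ fun h => hne (by rw [neg_add_eq_zero.1 h])

end Parametrized

/-! ### Reading the weights off the enumerator -/

section Coefficients

variable {F : Type*} [Field F] [DecidableEq F] {ι : Type*} [Fintype ι]

theorem coeff_weightEnumerator (C : Submodule F (ι → F)) {i : ℕ}
    (hi : i ∈ Finset.Icc 1 (Fintype.card ι)) :
    (weightEnumerator C).coeff i = weightCount C i := by
  have h0 : i ≠ 0 := by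
    have := (Finset.mem_Icc.1 hi).1
    omega
  rw [weightEnumerator, coeff_add, coeff_one, if_neg h0, zero_add, finsetSum_coeff,
    Finset.sum_eq_single i]
  · rw [← Polynomial.C_eq_natCast, coeff_C_mul, coeff_X_pow, if_pos rfl, mul_one]
  · intro j _ hj
    rw [← Polynomial.C_eq_natCast, coeff_C_mul, coeff_X_pow, if_neg hj.symm, mul_zero]
  · exact fun h => absurd hi h

/-- The weights of a code are read off the exponents of its weight enumerator. -/
theorem isWeightCode_of_weightEnumerator (C : Submodule F (ι → F)) (s : Finset ℕ) (a : ℕ → ℤ)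
    (hs : s ⊆ Finset.Icc 1 (Fintype.card ι)) (ha : ∀ i ∈ s, a i ≠ 0)
    (h : weightEnumerator C = 1 + ∑ i ∈ s, Polynomial.C (a i) * X ^ i) :
    IsWeightCode C s.card := by
  unfold IsWeightCode
  congr 1
  ext i
  rw [Finset.mem_filter]
  have key : i ∈ Finset.Icc 1 (Fintype.card ι) →
      (weightCount C i : ℤ) = if i ∈ s then a i else 0 := by
    intro hi
    have h0 : i ≠ 0 := by
      have := (Finset.mem_Icc.1 hi).1
      omega
    rw [← coeff_weightEnumerator C hi, h, coeff_add, coeff_one, if_neg h0, zero_add,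
      finsetSum_coeff]
    simp only [coeff_C_mul, coeff_X_pow, mul_ite, mul_one, mul_zero]
    rw [Finset.sum_ite_eq]
  constructor
  · rintro ⟨hi, hne⟩
    by_contra his
    have := key hi
    rw [if_neg his] at this
    exact hne (by exact_mod_cast this)
  · intro his
    refine ⟨hs his, fun h0 => ha i his ?_⟩
    have := key (hs his)
    rw [if_pos his, h0] at this
    exact this.symm

end Coefficients

/-! ### The model code: parallel affine functions on F² -/

section AffineCode

variable {F : Type*} [Field F]

/-- The evaluation of `r` affine functions on `F × F` that share their linear part. -/
def affineEval (F : Type*) [Field F] (r : ℕ) :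
    ((Fin r → F) × F × F) →ₗ[F] (Fin r × F × F → F) where
  toFun p := fun z => p.1 z.1 + p.2.1 * z.2.1 + p.2.2 * z.2.2
  map_add' p p' := by
    funext z
    simp only [Prod.fst_add, Prod.snd_add, Pi.add_apply]
    ring
  map_smul' c p := by
    funext z
    simp only [Prod.smul_fst, Prod.smul_snd, Pi.smul_apply, smul_eq_mul, RingHom.id_apply]
    ring

theorem affineEval_apply (r : ℕ) (p : (Fin r → F) × F × F) (z : Fin r × F × F) :
    affineEval F r p z = p.1 z.1 + p.2.1 * z.2.1 + p.2.2 * z.2.2 := rfl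

theorem affineEval_injective {r : ℕ} (hr : 0 < r) : Function.Injective (affineEval F r) := by
  rw [← LinearMap.ker_eq_bot, LinearMap.ker_eq_bot']
  rintro ⟨g, a, b⟩ h
  have hz : ∀ i x y, g i + a * x + b * y = 0 := fun i x y => congrFun h (i, x, y)
  have hg : g = 0 := funext fun i => by simpa using hz i 0 0
  subst hg
  have ha : a = 0 := by simpa using hz ⟨0, hr⟩ 1 0
  have hb : b = 0 := by simpa using hz ⟨0, hr⟩ 0 1
  rw [ha, hb]
  rfl

variable [Fintype F] [DecidableEq F]

theorem card_affine_eq_zero (c a b : F) (h : (a, b) ≠ 0) :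
    Finset.card {z : F × F | c + a * z.1 + b * z.2 = 0} = Fintype.card F := by
  rw [← Finset.card_univ]
  by_cases ha : a = 0
  · have hb : b ≠ 0 := fun hb => h (by rw [ha, hb]; rfl)
    refine (Finset.card_bij (fun x _ => (x, -(c / b))) ?_ ?_ ?_).symm
    · intro x _
      rw [Finset.mem_filter]
      refine ⟨Finset.mem_univ _, ?_⟩
      rw [ha]
      field_simp
      ring
    · intro x _ y _ hxy
      exact congrArg Prod.fst hxy
    · rintro ⟨x, y⟩ hz
      refine ⟨x, Finset.mem_univ _, ?_⟩
      have h0 : c + a * x + b * y = 0 := (Finset.mem_filter.1 hz).2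
      rw [ha] at h0
      refine Prod.ext rfl ?_
      change -(c / b) = y
      field_simp
      linear_combination -h0
  · refine (Finset.card_bij (fun y _ => (-((c + b * y) / a), y)) ?_ ?_ ?_).symm
    · intro y _
      rw [Finset.mem_filter]
      refine ⟨Finset.mem_univ _, ?_⟩
      field_simp
      ring
    · intro x _ y _ hxy
      exact congrArg Prod.snd hxy
    · rintro ⟨x, y⟩ hz
      refine ⟨y, Finset.mem_univ _, ?_⟩
      have h0 : c + a * x + b * y = 0 := (Finset.mem_filter.1 hz).2
      refine Prod.ext ?_ rfl
      change -((c + b * y) / a) = x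
      field_simp
      linear_combination -h0

theorem card_affine_ne_zero (c a b : F) (h : (a, b) ≠ 0) :
    Finset.card {z : F × F | c + a * z.1 + b * z.2 ≠ 0} =
      Fintype.card F * (Fintype.card F - 1) := by
  have h1 := Finset.card_filter_add_card_filter_not (s := (Finset.univ : Finset (F × F)))
    (fun z : F × F => c + a * z.1 + b * z.2 = 0)
  rw [card_affine_eq_zero c a b h, Finset.card_univ, Fintype.card_prod] at h1
  rw [Nat.mul_sub, mul_one]
  exact Nat.eq_sub_of_add_eq' h1

theorem hammingNorm_affineEval_eq_sum (r : ℕ) (p : (Fin r → F) × F × F) :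
    hammingNorm (affineEval F r p) =
      ∑ i : Fin r, Finset.card {z : F × F | p.1 i + p.2.1 * z.1 + p.2.2 * z.2 ≠ 0} := by
  rw [hammingNorm, Finset.card_filter, Fintype.sum_prod_type]
  refine Finset.sum_congr rfl fun i _ => ?_
  rw [Finset.card_filter]
  rfl

theorem hammingNorm_affineEval_of_ne_zero (r : ℕ) (p : (Fin r → F) × F × F) (h : p.2 ≠ 0) :
    hammingNorm (affineEval F r p) = r * (Fintype.card F * (Fintype.card F - 1)) := by
  rw [hammingNorm_affineEval_eq_sum, Finset.sum_congr rfl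
    (fun i _ => card_affine_ne_zero (p.1 i) p.2.1 p.2.2 h)]
  simp

theorem hammingNorm_affineEval_of_eq_zero (r : ℕ) (g : Fin r → F) :
    hammingNorm (affineEval F r (g, 0)) = Fintype.card F ^ 2 * hammingNorm g := by
  rw [hammingNorm_affineEval_eq_sum, hammingNorm, Finset.card_filter, Finset.mul_sum]
  refine Finset.sum_congr rfl fun i _ => ?_
  by_cases hi : g i = 0
  · simp [hi]
  · simp [hi, sq]

/-- With zero linear part the sum over the constants factors coordinatewise, giving the r-th power.
Each of the q² - 1 nonzero linear parts contributes q^r words of one and the same weight. -/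
theorem sum_X_pow_hammingNorm_affineEval (r : ℕ) :
    ∑ p : (Fin r → F) × F × F, (X : ℤ[X]) ^ hammingNorm (affineEval F r p) =
      (1 + ((Fintype.card F : ℤ[X]) - 1) * X ^ (Fintype.card F ^ 2)) ^ r +
        (Fintype.card F : ℤ[X]) ^ r * ((Fintype.card F : ℤ[X]) ^ 2 - 1) *
          X ^ (r * (Fintype.card F * (Fintype.card F - 1))) := by
  have hone : ∑ a : F, (X : ℤ[X]) ^ (Fintype.card F ^ 2 * if a ≠ 0 then 1 else 0) =
      1 + ((Fintype.card F : ℤ[X]) - 1) * X ^ (Fintype.card F ^ 2) := by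
    rw [← Finset.add_sum_erase _ _ (Finset.mem_univ (0 : F)),
      Finset.sum_congr rfl (g := fun _ => (X : ℤ[X]) ^ (Fintype.card F ^ 2))]
    · rw [Finset.sum_const, Finset.card_erase_of_mem (Finset.mem_univ _), Finset.card_univ,
        nsmul_eq_mul, Nat.cast_sub Fintype.card_pos]
      simp
    · intro a ha
      rw [if_pos (Finset.ne_of_mem_erase ha), mul_one]
  have hg : ∑ g : Fin r → F, (X : ℤ[X]) ^ (Fintype.card F ^ 2 * hammingNorm g) =
      (1 + ((Fintype.card F : ℤ[X]) - 1) * X ^ (Fintype.card F ^ 2)) ^ r := by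
    rw [← hone, Fintype.sum_pow]
    refine Finset.sum_congr rfl fun g _ => ?_
    rw [hammingNorm, Finset.card_filter, Finset.mul_sum, Finset.prod_pow_eq_pow_sum]
  rw [Fintype.sum_prod_type_right, ← Finset.add_sum_erase _ _ (Finset.mem_univ (0 : F × F))]
  congr 1
  · rw [← hg]
    exact Finset.sum_congr rfl fun g _ => by rw [hammingNorm_affineEval_of_eq_zero]
  · rw [Finset.sum_congr rfl (g := fun _ => (Fintype.card F : ℤ[X]) ^ r *
      X ^ (r * (Fintype.card F * (Fintype.card F - 1))))]
    · rw [Finset.sum_const, Finset.card_erase_of_mem (Finset.mem_univ _), Finset.card_univ,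
        nsmul_eq_mul, Nat.cast_sub Fintype.card_pos, Fintype.card_prod]
      push_cast
      ring
    · intro h hh
      rw [Finset.sum_congr rfl (fun g _ => by
        rw [hammingNorm_affineEval_of_ne_zero r (g, h) (Finset.ne_of_mem_erase hh)])]
      simp

end AffineCode

/-! ### From trace codes on parallel planes to the model code -/

section Transport

variable {F K : Type*} [Field F] [Field K] [Algebra F K]

/-- Every assignment of values to a linearly independent family is given by `x ↦ Tr (b x)`. -/
theorem exists_trace_mul_eq [FiniteDimensional F K] [Algebra.IsSeparable F K] {κ : Type*}
    {a : κ → K} (ha : LinearIndependent F a) (c : κ → F) :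
    ∃ b : K, ∀ i, Algebra.trace F K (b * a i) = c i := by
  -- The prescribed values define a functional on the span; any extension to `K` is represented by
  -- some b through the nondegenerate trace form.
  obtain ⟨f, hf⟩ := LinearMap.exists_extend ((Module.Basis.span ha).constr F c)
  have hfa : ∀ i, f (a i) = c i := fun i => by
    have h1 := LinearMap.congr_fun hf (Module.Basis.span ha i)
    rw [Module.Basis.constr_basis] at h1
    rw [← h1, LinearMap.comp_apply, Submodule.subtype_apply, Module.Basis.span_apply]
  refine ⟨((Algebra.traceForm F K).toDual (traceForm_nondegenerate F K)).symm f, fun i => ?_⟩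
  rw [← hfa i, ← Algebra.traceForm_apply]
  exact LinearMap.BilinForm.apply_toDual_symm_apply f (a i)

/-- A trace code whose defining set is a union of parallel affine planes in general position. -/
theorem exists_equiv_traceCode [FiniteDimensional F K] [Algebra.IsSeparable F K]
    {r : ℕ} (a : Fin r → K) (w : Fin 2 → K)
    (hli : LinearIndependent F (Sum.elim a w)) (D : Finset K)
    (hD : ∀ x, x ∈ D ↔ ∃ (i : Fin r) (s t : F), x = a i + (s • w 0 + t • w 1)) :
    ∃ ε : D ≃ Fin r × F × F,
      traceCode F D = LinearMap.range ((LinearMap.funLeft F F ε) ∘ₗ affineEval F r) := by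
  have htr : ∀ (b : K) (z : Fin r × F × F),
      Algebra.trace F K (b * (a z.1 + (z.2.1 • w 0 + z.2.2 • w 1))) =
        affineEval F r (fun i => Algebra.trace F K (b * a i),
          Algebra.trace F K (b * w 0), Algebra.trace F K (b * w 1)) z := by
    intro b z
    rw [affineEval_apply]
    simp only [mul_add, mul_smul_comm, map_add, map_smul, smul_eq_mul]
    ring
  let pt : Fin r × F × F → D := fun z => ⟨a z.1 + (z.2.1 • w 0 + z.2.2 • w 1),
    (hD _).2 ⟨z.1, z.2.1, z.2.2, rfl⟩⟩
  have hpt : Function.Bijective pt := by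
    constructor
    · intro z z' h
      have h' : a z.1 + (z.2.1 • w 0 + z.2.2 • w 1) = a z'.1 + (z'.2.1 • w 0 + z'.2.2 • w 1) :=
        congrArg Subtype.val h
      -- Trace functionals take arbitrary values on the family, so testing against indicator vectors
      -- c recovers the index and both coordinates of a point.
      have hval : ∀ c : Fin r ⊕ Fin 2 → F,
          c (Sum.inl z.1) + c (Sum.inr 0) * z.2.1 + c (Sum.inr 1) * z.2.2 =
          c (Sum.inl z'.1) + c (Sum.inr 0) * z'.2.1 + c (Sum.inr 1) * z'.2.2 := by
        intro c
        obtain ⟨b, hb⟩ := exists_trace_mul_eq hli c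
        have h1 := htr b z
        have h2 := htr b z'
        rw [h', h2] at h1
        simp only [affineEval_apply] at h1
        simp only [← hb, Sum.elim_inl, Sum.elim_inr]
        exact h1.symm
      have e1 := hval (Sum.elim (Pi.single z.1 1) 0)
      have e2 := hval (Sum.elim 0 (Pi.single 0 1))
      have e3 := hval (Sum.elim 0 (Pi.single 1 1))
      simp at e2 e3
      have e4 : z.1 = z'.1 := by
        by_contra hne
        simp [Pi.single_eq_of_ne (Ne.symm hne)] at e1
      exact Prod.ext e4 (Prod.ext e2 e3)
    · rintro ⟨x, hx⟩
      obtain ⟨i, s, t, rfl⟩ := (hD x).1 hx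
      exact ⟨(i, s, t), rfl⟩
  let ε := (Equiv.ofBijective pt hpt).symm
  have hε : ∀ d : D, (d : K) = a (ε d).1 + ((ε d).2.1 • w 0 + (ε d).2.2 • w 1) := fun d =>
    (congrArg Subtype.val (Equiv.ofBijective_apply_symm_apply pt hpt d)).symm
  refine ⟨ε, ?_⟩
  ext c
  rw [mem_traceCode]
  constructor
  · rintro ⟨b, rfl⟩
    refine ⟨(fun i => Algebra.trace F K (b * a i),
      Algebra.trace F K (b * w 0), Algebra.trace F K (b * w 1)), funext fun d => ?_⟩
    rw [LinearMap.comp_apply, LinearMap.funLeft_apply, ← htr, ← hε]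
  · rintro ⟨⟨g, h0, h1⟩, rfl⟩
    obtain ⟨b, hb⟩ := exists_trace_mul_eq hli (Sum.elim g ![h0, h1])
    have hp : (g, h0, h1) = (fun i => Algebra.trace F K (b * a i),
        Algebra.trace F K (b * w 0), Algebra.trace F K (b * w 1)) :=
      Prod.ext (funext fun i => (hb (Sum.inl i)).symm)
        (Prod.ext (hb (Sum.inr 0)).symm (hb (Sum.inr 1)).symm)
    refine ⟨b, funext fun d => ?_⟩
    rw [hε, htr, LinearMap.comp_apply, LinearMap.funLeft_apply, hp]

theorem hammingNorm_funLeft [DecidableEq F] {ι κ : Type*} [Fintype ι] [Fintype κ] (ε : ι ≃ κ)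
    (f : κ → F) : hammingNorm (LinearMap.funLeft F F ε f) = hammingNorm f := by
  unfold hammingNorm
  rw [Finset.card_filter, Finset.card_filter]
  exact Equiv.sum_comp ε fun k => if f k ≠ 0 then 1 else 0

end Transport

/-! ### Frobenius on the quartic extension and the shape of D₁ -/

section QuarticExtension

variable {F K : Type*} [Field F] [Fintype F] [Field K] [Algebra F K]

local notation "σ" => FiniteField.frobeniusAlgHom F K

/-- Root count for X^n - cX. It bounds both the fixed field of Frobenius (n = q) and the eigenspaces
of its square (n = q²). -/
theorem card_pow_eq_mul_le [Fintype K] [DecidableEq K] (c : K) {n : ℕ} (hn : 1 < n) :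
    Finset.card {x : K | x ^ n = c * x} ≤ n := by
  have hdeg : (C c * X : K[X]).natDegree < n := (natDegree_C_mul_le c X).trans_lt (by rwa [natDegree_X])
  have hn' : (X ^ n - C c * X : K[X]).natDegree = n := by
    rw [natDegree_sub_eq_left_of_natDegree_lt (by rwa [natDegree_X_pow]), natDegree_X_pow]
  have h0 : (X ^ n - C c * X : K[X]) ≠ 0 := fun h => by
    rw [h, natDegree_zero] at hn'
    omega
  calc Finset.card {x : K | x ^ n = c * x} ≤ (X ^ n - C c * X : K[X]).roots.toFinset.card := by
        refine Finset.card_le_card fun x hx => ?_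
        rw [Multiset.mem_toFinset, mem_roots h0]
        simpa [sub_eq_zero] using hx
    _ ≤ Multiset.card (X ^ n - C c * X : K[X]).roots := Multiset.toFinset_card_le _
    _ ≤ n := (card_roots' _).trans hn'.le

theorem frobenius_frobenius_apply (x : K) : σ (σ x) = x ^ (Fintype.card F ^ 2) := by
  change (x ^ Fintype.card F) ^ Fintype.card F = _
  rw [← pow_mul, sq]

theorem frobenius_pow_four [Finite K] (hm : Module.finrank F K = 4) (x : K) :
    σ (σ (σ (σ x))) = x := by
  have := Fintype.ofFinite K
  rw [frobenius_frobenius_apply, frobenius_frobenius_apply, ← pow_mul, ← pow_add,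
    show 2 + 2 = Module.finrank F K from hm.symm, ← Module.card_eq_pow_finrank, FiniteField.pow_card]

/-- An odd power of σ is σ or σ³, because σ⁴ = 1. -/
theorem pow_card_pow_of_odd [Finite K] (hm : Module.finrank F K = 4) {e : ℕ} (he : Odd e)
    (x : K) : x ^ Fintype.card F ^ e = σ x ∨ x ^ Fintype.card F ^ e = σ (σ (σ x)) := by
  obtain ⟨k, rfl⟩ := he
  induction k with
  | zero => exact Or.inl (by rw [mul_zero, zero_add, pow_one]; rfl)
  | succ k ih =>
    have h : x ^ Fintype.card F ^ (2 * (k + 1) + 1) =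
        σ (σ (x ^ Fintype.card F ^ (2 * k + 1))) := by
      rw [frobenius_frobenius_apply, ← pow_mul, ← pow_add]
      ring_nf
    rw [h]
    rcases ih with h | h <;> rw [h]
    · exact Or.inr rfl
    · exact Or.inl (frobenius_pow_four hm _)

theorem algebraMap_trace_quartic [Finite K] (hm : Module.finrank F K = 4) (x : K) :
    algebraMap F K (Algebra.trace F K x) = x + σ x + σ (σ x) + σ (σ (σ x)) := by
  rw [FiniteField.algebraMap_trace_eq_sum_pow, hm, Nat.card_eq_fintype_card]
  simp only [Finset.sum_range_succ, Finset.sum_range_zero, zero_add, pow_zero, pow_one]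
  rw [frobenius_frobenius_apply (σ x), frobenius_frobenius_apply x]
  change _ = x + x ^ Fintype.card F + _ + (x ^ Fintype.card F) ^ Fintype.card F ^ 2
  rw [← pow_mul, ← pow_succ']

theorem algebraMap_trace_eq_add [Finite K] (hm : Module.finrank F K = 4) (x : K) :
    algebraMap F K (Algebra.trace F K x) = (x + σ (σ x)) + σ (x + σ (σ x)) := by
  rw [algebraMap_trace_quartic hm, map_add]
  ring

/-- For the exponent σ the trace is xσx + σxσ²x + σ²xσ³x + σ³x·x = (x + σ²x)(σx + σ³x); replacing σ
by σ³ permutes the same four terms. -/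
theorem algebraMap_trace_pow_eq_mul [Finite K] (hm : Module.finrank F K = 4) {e : ℕ}
    (he : Odd e) (x : K) :
    algebraMap F K (Algebra.trace F K (x ^ (Fintype.card F ^ e + 1))) =
      (x + σ (σ x)) * σ (x + σ (σ x)) := by
  rw [algebraMap_trace_quartic hm, pow_succ, map_add]
  rcases pow_card_pow_of_odd hm he x with h | h <;> rw [h] <;>
    simp only [map_mul, frobenius_pow_four hm] <;> ring

/-- The image of `F` already supplies q roots of X^q = X, which is all there can be. -/
theorem exists_algebraMap_of_frobenius_eq [Finite K] {x : K} (hx : σ x = x) :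
    ∃ c : F, algebraMap F K c = x := by
  classical
  have := Fintype.ofFinite K
  have hsub : (Finset.univ : Finset F).image (algebraMap F K) ⊆
      ({x : K | x ^ Fintype.card F = 1 * x} : Finset K) := by
    intro y hy
    obtain ⟨c, -, rfl⟩ := Finset.mem_image.1 hy
    rw [Finset.mem_filter, one_mul, ← map_pow, FiniteField.pow_card]
    exact ⟨Finset.mem_univ _, rfl⟩
  have heq := Finset.eq_of_subset_of_card_le hsub (by
    rw [Finset.card_image_of_injective _ (algebraMap F K).injective, Finset.card_univ]
    exact card_pow_eq_mul_le 1 Fintype.one_lt_card)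
  have hmem : x ∈ ({x : K | x ^ Fintype.card F = 1 * x} : Finset K) := by
    rw [Finset.mem_filter, one_mul]
    exact ⟨Finset.mem_univ _, hx⟩
  rw [← heq] at hmem
  obtain ⟨c, -, hc⟩ := Finset.mem_image.1 hmem
  exact ⟨c, hc⟩

variable (F K) in
/-- The eigenspace of the square of Frobenius for the eigenvalue `c`. -/
noncomputable def sqEigenspace (c : F) : Submodule F K :=
  LinearMap.ker ((σ).toLinearMap ∘ₗ (σ).toLinearMap - c • LinearMap.id)

theorem mem_sqEigenspace {c : F} {x : K} : x ∈ sqEigenspace F K c ↔ σ (σ x) = c • x := by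
  rw [sqEigenspace, LinearMap.mem_ker, LinearMap.sub_apply, sub_eq_zero]
  rfl

theorem finrank_sqEigenspace_le [Finite K] (c : F) :
    Module.finrank F (sqEigenspace F K c) ≤ 2 := by
  classical
  have := Fintype.ofFinite K
  have hq : 1 < Fintype.card F := Fintype.one_lt_card
  have h1 := card_pow_eq_mul_le (algebraMap F K c) (Nat.one_lt_pow two_ne_zero hq)
  have h2 : Fintype.card (sqEigenspace F K c) =
      Finset.card {x : K | x ^ (Fintype.card F ^ 2) = algebraMap F K c * x} := by
    rw [Fintype.card_subtype]
    congr 1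
    ext x
    simp only [Finset.mem_filter, Finset.mem_univ, true_and]
    rw [mem_sqEigenspace, frobenius_frobenius_apply, Algebra.smul_def]
  rw [← h2, Module.card_eq_pow_finrank (K := F)] at h1
  exact (Nat.pow_le_pow_iff_right hq).1 h1

theorem disjoint_sqEigenspace (h2 : (2 : F) ≠ 0) :
    Disjoint (sqEigenspace F K 1) (sqEigenspace F K (-1)) := by
  rw [Submodule.disjoint_def]
  intro x hx hx'
  rw [mem_sqEigenspace, one_smul] at hx
  rw [mem_sqEigenspace, hx] at hx'
  have h : (2 : F) • x = 0 := by
    rw [two_smul]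
    nth_rw 1 [hx']
    simp
  exact (smul_eq_zero.1 h).resolve_left h2

/-- Since σ² is an involution and 2 is invertible, `K` splits into the two eigenspaces. Each has
dimension at most 2 and the total is 4, so both bounds are equalities. -/
theorem finrank_sqEigenspace_neg_one [Finite K] (h2 : (2 : F) ≠ 0)
    (hm : Module.finrank F K = 4) : Module.finrank F (sqEigenspace F K (-1)) = 2 := by
  have : FiniteDimensional F K := Module.finite_of_finrank_pos (by omega)
  have hcompl : IsCompl (sqEigenspace F K 1) (sqEigenspace F K (-1)) := by
    refine ⟨disjoint_sqEigenspace h2, codisjoint_iff.2 (eq_top_iff.2 fun x _ => ?_)⟩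
    refine Submodule.mem_sup.2 ⟨(2 : F)⁻¹ • (x + σ (σ x)), ?_, (2 : F)⁻¹ • (x - σ (σ x)), ?_, ?_⟩
    · rw [mem_sqEigenspace]
      simp only [map_smul, map_add, frobenius_pow_four hm, one_smul]
      rw [add_comm]
    · rw [mem_sqEigenspace]
      simp only [map_smul, map_sub, frobenius_pow_four hm]
      rw [neg_smul, one_smul, ← smul_neg, neg_sub]
    · rw [← smul_add, add_add_sub_cancel, ← two_smul F x, inv_smul_smul₀ h2]
  have h := Submodule.finrank_add_eq_of_isCompl hcompl
  have h1 := finrank_sqEigenspace_le (K := K) (1 : F)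
  have h3 := finrank_sqEigenspace_le (K := K) (-1 : F)
  omega

/-- A square root in `K` of an element of `F` that is zero or not a square. -/
theorem exists_sq_eq_frobenius_eq_neg [Finite K] (h2 : (2 : F) ≠ 0)
    (hm : Module.finrank F K = 4) {δ : F} (hδ : δ = 0 ∨ ¬ IsSquare δ) :
    ∃ t : K, t ^ 2 = algebraMap F K δ ∧ σ t = -t := by
  rcases hδ with rfl | hδ
  · exact ⟨0, by simp, by simp⟩
  have := Fintype.ofFinite K
  have hδ0 : δ ≠ 0 := fun h => hδ (by rw [h]; exact IsSquare.zero)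
  have hF2 : ringChar F ≠ 2 := fun h => h2 (by
    have := ringChar.Nat.cast_ringChar (R := F)
    rw [h] at this
    exact_mod_cast this)
  have hK2 : ringChar K ≠ 2 := by
    rwa [← Algebra.ringChar_eq F K]
  have hodd : Odd (Fintype.card F) := Nat.odd_iff.2 (FiniteField.odd_card_of_char_ne_two hF2)
  obtain ⟨k, hk⟩ := hodd
  -- With q = 2k + 1, (q⁴ - 1)/2 = (q - 1)·((q + 1)/2)·(q² + 1) is a multiple of q - 1, so by
  -- Euler's criterion every nonzero element of `F` is a square in `K`.
  have hcard : Fintype.card K / 2 =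
      (Fintype.card F - 1) * ((k + 1) * (Fintype.card F ^ 2 + 1)) := by
    rw [Module.card_eq_pow_finrank (K := F), hm, hk, Nat.add_sub_cancel]
    have : (2 * k + 1) ^ 4 = 2 * (2 * k * ((k + 1) * ((2 * k + 1) ^ 2 + 1))) + 1 := by ring
    omega
  have hsq : IsSquare (algebraMap F K δ) := by
    rw [FiniteField.isSquare_iff hK2 ((_root_.map_ne_zero _).2 hδ0), hcard, pow_mul, ← map_pow,
      FiniteField.pow_card_sub_one_eq_one δ hδ0, map_one, one_pow]
  obtain ⟨t, ht⟩ := hsq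
  have ht2 : t ^ 2 = algebraMap F K δ := by rw [ht, sq]
  refine ⟨t, ht2, ?_⟩
  have hσ : σ t ^ 2 = t ^ 2 := by rw [← map_pow, ht2, AlgHom.commutes]
  -- If σt = t, then t lies in `F` and δ would be a square there.
  refine (sq_eq_sq_iff_eq_or_eq_neg.1 hσ).resolve_left fun h => hδ ?_
  obtain ⟨c, hc⟩ := exists_algebraMap_of_frobenius_eq h
  refine ⟨c, (algebraMap F K).injective ?_⟩
  rw [map_mul, hc, ← sq, ht2]

variable [DecidableEq F] [Fintype K] [DecidableEq K]

/-- The sum and product of z = x + σ²x and σz are v and u, so 2z = v ± t by the quadratic formula.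
Conversely, σt = -t makes σz the other root. The condition x ≠ 0 is automatic from Tr(x) = v ≠ 0. -/
theorem mem_definingSet₁_iff (h2 : (2 : F) ≠ 0) (hm : Module.finrank F K = 4) {e : ℕ}
    (he : Odd e) {u v : F} (hv : v ≠ 0) {t : K} (ht : t ^ 2 = algebraMap F K (v ^ 2 - 4 * u))
    (hσt : σ t = -t) (x : K) :
    x ∈ definingSet₁ K e u v ↔
      x - (algebraMap F K v + t) / 4 ∈ sqEigenspace F K (-1) ∨
      x - (algebraMap F K v - t) / 4 ∈ sqEigenspace F K (-1) := by
  have h2K : (2 : K) ≠ 0 := by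
    rw [← map_ofNat (algebraMap F K) 2]
    exact (_root_.map_ne_zero _).2 h2
  have h4K : (4 : K) ≠ 0 := by
    rw [show (4 : K) = 2 * 2 by norm_num]
    exact mul_ne_zero h2K h2K
  have hinj := (algebraMap F K).injective
  have hx0 : Algebra.trace F K x = v → x ≠ 0 := by
    rintro h rfl
    exact hv (by rw [← h, map_zero])
  have hmem : x ∈ definingSet₁ K e u v ↔
      (x + σ (σ x)) * σ (x + σ (σ x)) = algebraMap F K u ∧
        (x + σ (σ x)) + σ (x + σ (σ x)) = algebraMap F K v := by
    rw [definingSet₁, Finset.mem_filter, ← algebraMap_trace_pow_eq_mul hm he,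
      ← algebraMap_trace_eq_add hm, hinj.eq_iff, hinj.eq_iff]
    exact ⟨fun h => h.2.2, fun h => ⟨Finset.mem_univ _, hx0 h.2, h⟩⟩
  -- As σ² fixes (v + r)/4, lying in its coset of the -1-eigenspace means x + σ²x = (v + r)/2. Both
  -- signs ± t are covered by taking r = t and r = -t.
  have hσ2 : ∀ r : K, σ r = -r → (x - (algebraMap F K v + r) / 4 ∈ sqEigenspace F K (-1) ↔
      2 * (x + σ (σ x)) = algebraMap F K v + r) := by
    intro r hr
    rw [mem_sqEigenspace, neg_smul, one_smul]
    simp only [map_sub, map_div₀, map_add, AlgHom.commutes, hr, map_neg, neg_neg, map_ofNat]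
    constructor
    · intro h
      have h' : 4 * (σ (σ x) + x) = 2 * (algebraMap F K v + r) := by
        field_simp at h
        linear_combination h
      refine mul_left_cancel₀ h2K ?_
      linear_combination h'
    · intro h
      field_simp
      linear_combination 2 * h
  rw [hmem, hσ2 t hσt, sub_eq_add_neg (algebraMap F K v) t, hσ2 (-t) (by rw [map_neg, hσt])]
  simp only [map_sub, map_mul, map_pow, map_ofNat] at ht
  generalize hz : x + σ (σ x) = z
  constructor
  · rintro ⟨hN, hT⟩
    -- Both sides equal (z - σz)².
    have h : (2 * z - algebraMap F K v) ^ 2 = t ^ 2 := by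
      rw [ht, ← hN, ← hT]
      ring
    rcases sq_eq_sq_iff_eq_or_eq_neg.1 h with h | h
    · exact Or.inl (by linear_combination h)
    · exact Or.inr (by linear_combination h)
  · intro h
    have key : ∀ r : K, σ r = -r → r ^ 2 = t ^ 2 → 2 * z = algebraMap F K v + r →
        z * σ z = algebraMap F K u ∧ z + σ z = algebraMap F K v := by
      intro r hr hrt hzr
      have hσz : 2 * σ z = algebraMap F K v - r := by
        have := congrArg (σ) hzr
        simp only [map_mul, map_add, map_ofNat, AlgHom.commutes, hr] at this
        linear_combination this
      constructor
      · refine mul_left_cancel₀ h4K ?_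
        linear_combination 2 * σ z * hzr + (algebraMap F K v + r) * hσz - hrt - ht
      · refine mul_left_cancel₀ h2K ?_
        linear_combination hzr + hσz
    rcases h with h | h
    · exact key t hσt rfl h
    · exact key (-t) (by rw [map_neg, hσt]) (neg_sq t) h

end QuarticExtension

/-! ### Griesmer and Plotkin bounds -/

section Bounds

variable {F : Type*} [Field F]

theorem finrank_le_finrank_ker_add_one {V : Type*} [AddCommGroup V] [Module F V]
    [FiniteDimensional F V] (f : V →ₗ[F] F) :
    Module.finrank F V ≤ Module.finrank F (LinearMap.ker f) + 1 := by
  have h1 := f.finrank_range_add_finrank_ker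
  have h2 := Submodule.finrank_le (LinearMap.range f)
  rw [Module.finrank_self] at h2
  omega

variable [Fintype F]

variable (F) in
-- The three terms are q² - q, q - 1 and ⌈1 - 1/q⌉ = 1.
theorem meetsGriesmerBound_sq : MeetsGriesmerBound F (Fintype.card F ^ 2) 3
    (Fintype.card F ^ 2 - Fintype.card F) := by
  unfold MeetsGriesmerBound
  have hq : 1 < Fintype.card F := Fintype.one_lt_card
  generalize Fintype.card F = q at *
  have hqq : q ≤ q ^ 2 := Nat.le_self_pow two_ne_zero q
  have hq0 : (0 : ℚ) < q := by exact_mod_cast (by omega : 0 < q)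
  have hq1 : (1 : ℚ) < q := by exact_mod_cast hq
  have h0 : ⌈((q ^ 2 - q : ℕ) : ℚ) / (q : ℚ) ^ 0⌉₊ = q ^ 2 - q := by
    rw [pow_zero, div_one, Nat.ceil_natCast]
  have h1 : ⌈((q ^ 2 - q : ℕ) : ℚ) / (q : ℚ) ^ 1⌉₊ = q - 1 := by
    have : ((q ^ 2 - q : ℕ) : ℚ) / (q : ℚ) ^ 1 = ((q - 1 : ℕ) : ℚ) := by
      rw [Nat.cast_sub hqq, Nat.cast_sub hq.le]
      push_cast
      field_simp
    rw [this, Nat.ceil_natCast]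
  have h2 : ⌈((q ^ 2 - q : ℕ) : ℚ) / (q : ℚ) ^ 2⌉₊ = 1 := by
    rw [Nat.ceil_eq_iff one_ne_zero, Nat.cast_sub hqq]
    push_cast
    constructor
    · have : (0 : ℚ) < (q : ℚ) ^ 2 - q := by nlinarith
      simpa using div_pos this (by positivity)
    · rw [div_le_one (by positivity)]
      linarith
  rw [Finset.sum_range_succ, Finset.sum_range_succ, Finset.sum_range_one, h0, h1, h2]
  omega

variable [DecidableEq F] {ι : Type*} [Fintype ι]

/-- The Plotkin bound for a linear code supported on a set `S` of coordinates. -/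
theorem plotkin_bound (C : Submodule F (ι → F)) (S : Finset ι) {k d : ℕ}
    (hk : Module.finrank F C = k + 1) (hd : ∀ c ∈ C, c ≠ 0 → d ≤ hammingNorm c)
    (hS : ∀ c ∈ C, ∀ i, i ∉ S → c i = 0) :
    d * (Fintype.card F ^ (k + 1) - 1) + S.card * Fintype.card F ^ k ≤
      S.card * Fintype.card F ^ (k + 1) := by
  classical
  have := Fintype.ofFinite C
  have hcard : Fintype.card C = Fintype.card F ^ (k + 1) := by
    rw [Module.card_eq_pow_finrank (K := F), hk]
  -- The total weight of the code is counted twice: by codewords here, by coordinates below.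
  have hlow : d * (Fintype.card F ^ (k + 1) - 1) ≤ ∑ c : C, hammingNorm (c : ι → F) := by
    rw [← hcard, ← Finset.card_univ, ← Finset.card_erase_of_mem (Finset.mem_univ (0 : C)),
      mul_comm, ← smul_eq_mul, ← Finset.sum_const]
    refine (Finset.sum_le_sum fun c hc => ?_).trans
      (Finset.sum_le_sum_of_subset (Finset.erase_subset _ _))
    exact hd c c.2 fun h => Finset.ne_of_mem_erase hc (Subtype.ext h)
  have hswap : ∑ c : C, hammingNorm (c : ι → F) =
      ∑ i ∈ S, Finset.card {c : C | (c : ι → F) i ≠ 0} := by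
    simp only [hammingNorm, Finset.card_filter]
    rw [Finset.sum_comm]
    refine (Finset.sum_subset (Finset.subset_univ S) fun i _ hi => ?_).symm
    exact Finset.sum_eq_zero fun c _ => if_neg (not_not.2 (hS c c.2 i hi))
  -- A coordinate functional has a kernel of codimension at most 1, so at least q^k words vanish
  -- there.
  have hcoord : ∀ i, Finset.card {c : C | (c : ι → F) i ≠ 0} + Fintype.card F ^ k ≤
      Fintype.card F ^ (k + 1) := by
    intro i
    let f : C →ₗ[F] F := (LinearMap.proj i).comp C.subtype
    have hker : Finset.card {c : C | (c : ι → F) i = 0} =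
        Fintype.card F ^ Module.finrank F (LinearMap.ker f) := by
      rw [← Module.card_eq_pow_finrank (K := F) (V := LinearMap.ker f), Fintype.card_subtype]
      congr 1
      ext c
      simp [f]
    have hle : Fintype.card F ^ k ≤ Finset.card {c : C | (c : ι → F) i = 0} := by
      rw [hker]
      have := finrank_le_finrank_ker_add_one f
      exact Nat.pow_le_pow_right Fintype.card_pos (by omega)
    have := Finset.card_filter_add_card_filter_not (s := (Finset.univ : Finset C))
      (fun c : C => (c : ι → F) i = 0)
    rw [Finset.card_univ, hcard] at this
    calc _ ≤ Finset.card {c : C | (c : ι → F) i ≠ 0} +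
          Finset.card {c : C | (c : ι → F) i = 0} := Nat.add_le_add_left hle _
      _ = _ := by rw [add_comm]; exact this
  calc _ ≤ ∑ i ∈ S, Finset.card {c : C | (c : ι → F) i ≠ 0} + S.card * Fintype.card F ^ k :=
        Nat.add_le_add_right (hlow.trans hswap.le) _
    _ = ∑ i ∈ S, (Finset.card {c : C | (c : ι → F) i ≠ 0} + Fintype.card F ^ k) := by
        rw [Finset.sum_add_distrib, Finset.sum_const, smul_eq_mul]
    _ ≤ ∑ i ∈ S, Fintype.card F ^ (k + 1) := Finset.sum_le_sum fun i _ => hcoord i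
    _ = _ := by rw [Finset.sum_const, smul_eq_mul]

/-- In dimension k + 3, a support of at most q² - 1 coordinates would violate Plotkin by at least
q(q - 1)(q^(k+1) - 1) > 0. Allowing a support `S` lets the bound apply to a subcode vanishing at a
coordinate without changing the index type. -/
theorem sq_card_le_card_support (C : Submodule F (ι → F)) (S : Finset ι) {d : ℕ}
    (hk : 3 ≤ Module.finrank F C) (hd : ∀ c ∈ C, c ≠ 0 → d ≤ hammingNorm c)
    (hS : ∀ c ∈ C, ∀ i, i ∉ S → c i = 0) (hd' : Fintype.card F ^ 2 - Fintype.card F ≤ d) :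
    Fintype.card F ^ 2 ≤ S.card := by
  have hq : 1 < Fintype.card F := Fintype.one_lt_card
  obtain ⟨k, hk'⟩ : ∃ k, Module.finrank F C = k + 2 + 1 := ⟨Module.finrank F C - 3, by omega⟩
  have h := plotkin_bound C S hk' hd hS
  by_contra! hlt
  generalize Fintype.card F = q at *
  have hQ : 1 ≤ q ^ k := Nat.one_le_pow _ _ (by omega)
  have hP : 1 ≤ q ^ (k + 2 + 1) := Nat.one_le_pow _ _ (by omega)
  have hqq : q ≤ q ^ 2 := Nat.le_self_pow two_ne_zero q
  zify [hP] at h hQ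
  zify [hqq] at hd' hlt hq
  rw [pow_succ, pow_add] at h
  generalize (q : ℤ) ^ k = Q at *
  generalize (q : ℤ) = a at *
  generalize (d : ℤ) = d at *
  generalize (S.card : ℤ) = N at *
  have hp : 0 ≤ Q * a ^ 2 * (a - 1) := by
    have : 0 ≤ a - 1 := by linarith
    positivity
  have hp' : 0 ≤ Q * a ^ 2 * a - 1 := by nlinarith
  have h1 : (a ^ 2 - a) * (Q * a ^ 2 * a - 1) ≤ d * (Q * a ^ 2 * a - 1) :=
    mul_le_mul_of_nonneg_right hd' hp'
  have h2 : N * (Q * a ^ 2 * (a - 1)) ≤ (a ^ 2 - 1) * (Q * a ^ 2 * (a - 1)) :=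
    mul_le_mul_of_nonneg_right (by linarith) hp
  have h3 : (a - 1) * (a * (Q * a - 1)) ≤ 0 := by linarith
  have h4 : 0 < Q * a - 1 := by nlinarith
  have h5 : 0 < (a - 1) * (a * (Q * a - 1)) :=
    mul_pos (by linarith) (mul_pos (by linarith) h4)
  linarith

/-- No linear code improves on the parameters `[q ^ 2, 3, q ^ 2 - q]`. -/
theorem parameters_eq_of_isLinearCode {n k d : ℕ} (C : Submodule F (Fin n → F))
    (hC : IsLinearCode C n k d) (hn : n ≤ Fintype.card F ^ 2) (hk : 3 ≤ k)
    (hd : Fintype.card F ^ 2 - Fintype.card F ≤ d) :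
    n = Fintype.card F ^ 2 ∧ k = 3 ∧ d = Fintype.card F ^ 2 - Fintype.card F := by
  obtain ⟨-, hfin, -, hmin⟩ := hC
  have hq : 1 < Fintype.card F := Fintype.one_lt_card
  have hmin' : ∀ c ∈ C, c ≠ 0 → d ≤ hammingNorm c := fun c hc h0 =>
    hmin ⟨c, hc, 0, zero_mem _, h0, hammingDist_zero_right c⟩
  have hn' : n = Fintype.card F ^ 2 := by
    refine le_antisymm hn ?_
    have := sq_card_le_card_support C Finset.univ (hfin.symm ▸ hk) hmin'
      (fun _ _ i hi => absurd (Finset.mem_univ i) hi) hd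
    rwa [Finset.card_univ, Fintype.card_fin] at this
  have hk' : k = 3 := by
    refine le_antisymm ?_ hk
    -- For k ≥ 4, the words vanishing at one coordinate would form a code of dimension at least 3
    -- supported on q² - 1 coordinates.
    by_contra! hk4
    have hpos : 0 < n := by rw [hn']; positivity
    let i : Fin n := ⟨0, hpos⟩
    let f : C →ₗ[F] F := (LinearMap.proj i).comp C.subtype
    have hsub : ∀ c ∈ (LinearMap.ker f).map C.subtype, c ∈ C ∧ c i = 0 := by
      rintro _ ⟨c, hc, rfl⟩
      exact ⟨c.2, hc⟩
    have := sq_card_le_card_support ((LinearMap.ker f).map C.subtype) (Finset.univ.erase i)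
      (d := d) (by
        rw [Submodule.finrank_map_subtype_eq]
        have := finrank_le_finrank_ker_add_one f
        omega)
      (fun c hc => hmin' c (hsub c hc).1)
      (fun c hc j hj => by
        have hji : j = i := by simpa using hj
        rw [hji]
        exact (hsub c hc).2) hd
    rw [Finset.card_erase_of_mem (Finset.mem_univ i), Finset.card_univ, Fintype.card_fin] at this
    omega
  refine ⟨hn', hk', le_antisymm ?_ hd⟩
  -- Plotkin in dimension 3 and length q²: d ≥ q² - q + 1 would exceed it by at least (q² + 1)(q -
  -- 1) > 0.
  have h := plotkin_bound C Finset.univ (k := 2) (by rw [hfin, hk']) hmin'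
    (fun _ _ i hi => absurd (Finset.mem_univ i) hi)
  rw [Finset.card_univ, Fintype.card_fin, hn'] at h
  by_contra! hlt
  generalize Fintype.card F = q at *
  have hP : 1 ≤ q ^ (2 + 1) := Nat.one_le_pow _ _ (by omega)
  have hqq : q ≤ q ^ 2 := Nat.le_self_pow two_ne_zero q
  zify [hP] at h
  zify [hqq] at hlt hq
  generalize (q : ℤ) = a at *
  generalize (d : ℤ) = d at *
  simp only [Nat.reduceAdd] at h
  have hp : 0 ≤ a ^ 3 - 1 := by nlinarith [sq_nonneg a]
  have h1 : (a ^ 2 - a + 1) * (a ^ 3 - 1) ≤ d * (a ^ 3 - 1) :=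
    mul_le_mul_of_nonneg_right (by linarith) hp
  have h2 : (a ^ 2 + 1) * (a - 1) ≤ 0 := by linarith
  have h3 : 0 < (a ^ 2 + 1) * (a - 1) := mul_pos (by positivity) (by linarith)
  linarith

end Bounds

/-! ### Cosets of the -1-eigenspace -/

section DefiningSet

variable {F K : Type*} [Field F] [Fintype F] [Field K] [Algebra F K]

/-- A trace code on a union of cosets of the `-1`-eigenspace of the square of Frobenius whose
representatives lie in the `1`-eigenspace and are independent. -/
theorem exists_equiv_traceCode_of_cosets [Finite K] (h2 : (2 : F) ≠ 0)
    (hm : Module.finrank F K = 4) {r : ℕ} (a : Fin r → K) (ha : LinearIndependent F a)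
    (ha' : ∀ i, a i ∈ sqEigenspace F K 1) (D : Finset K)
    (hD : ∀ x, x ∈ D ↔ ∃ i, x - a i ∈ sqEigenspace F K (-1)) :
    ∃ ε : D ≃ Fin r × F × F,
      traceCode F D = LinearMap.range ((LinearMap.funLeft F F ε) ∘ₗ affineEval F r) := by
  have : FiniteDimensional F K := Module.finite_of_finrank_pos (by omega)
  let b := Module.finBasisOfFinrankEq F (sqEigenspace F K (-1))
    (finrank_sqEigenspace_neg_one h2 hm)
  let w : Fin 2 → K := fun j => b j
  have hw : LinearIndependent F w :=
    b.linearIndependent.map' (sqEigenspace F K (-1)).subtype (Submodule.ker_subtype _)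
  have hli : LinearIndependent F (Sum.elim a w) := by
    -- The two families span subspaces of different eigenspaces of σ², which meet trivially.
    refine ha.sum_type hw ((disjoint_sqEigenspace h2).mono ?_ ?_) <;> rw [Submodule.span_le]
    · rintro _ ⟨i, rfl⟩
      exact ha' i
    · rintro _ ⟨j, rfl⟩
      exact (b j).2
  refine exists_equiv_traceCode a w hli D fun x => (hD x).trans (exists_congr fun i => ?_)
  constructor
  · intro hx
    have h := b.sum_repr ⟨x - a i, hx⟩
    rw [Fin.sum_univ_two] at h
    refine ⟨b.repr ⟨x - a i, hx⟩ 0, b.repr ⟨x - a i, hx⟩ 1, ?_⟩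
    rw [← sub_eq_iff_eq_add']
    exact (congrArg Subtype.val h).symm
  · rintro ⟨s, t, rfl⟩
    rw [add_sub_cancel_left]
    exact add_mem (Submodule.smul_mem _ _ (b 0).2) (Submodule.smul_mem _ _ (b 1).2)

end DefiningSet

/-! ### Parameters and enumerator after relabelling coordinates -/

section AffineTraceCode

theorem card_of_equiv_affine {F ι : Type*} [Fintype F] [Fintype ι] {r : ℕ}
    (ε : ι ≃ Fin r × F × F) : Fintype.card ι = r * Fintype.card F ^ 2 := by
  rw [Fintype.card_congr ε]
  simp [sq]

theorem funLeft_comp_affineEval_injective {F ι : Type*} [Field F] {r : ℕ} (hr : 0 < r)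
    (ε : ι ≃ Fin r × F × F) :
    Function.Injective ((LinearMap.funLeft F F ε) ∘ₗ affineEval F r) := by
  rw [LinearMap.coe_comp]
  exact (LinearMap.funLeft_injective_of_surjective F F ε ε.surjective).comp
    (affineEval_injective hr)

variable {F : Type*} [Field F] [Fintype F] [DecidableEq F] {ι : Type*} [Fintype ι] {r : ℕ}

theorem weightEnumerator_affine (hr : 0 < r) (ε : ι ≃ Fin r × F × F) :
    weightEnumerator (LinearMap.range ((LinearMap.funLeft F F ε) ∘ₗ affineEval F r)) =
      (1 + ((Fintype.card F : ℤ[X]) - 1) * X ^ (Fintype.card F ^ 2)) ^ r +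
        (Fintype.card F : ℤ[X]) ^ r * ((Fintype.card F : ℤ[X]) ^ 2 - 1) *
          X ^ (r * (Fintype.card F * (Fintype.card F - 1))) := by
  rw [weightEnumerator_range _ (funLeft_comp_affineEval_injective hr ε),
    ← sum_X_pow_hammingNorm_affineEval]
  exact Finset.sum_congr rfl fun p _ => by rw [LinearMap.comp_apply, hammingNorm_funLeft]

/-- The smallest weight is r·q(q - 1), from a nonzero linear part, or q², from a single nonzero
constant; both kinds of word exist since r > 0. -/
theorem isLinearCode_affine (hr : 0 < r) (ε : ι ≃ Fin r × F × F) {d : ℕ}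
    (hd : d = min (r * (Fintype.card F * (Fintype.card F - 1))) (Fintype.card F ^ 2)) :
    IsLinearCode (LinearMap.range ((LinearMap.funLeft F F ε) ∘ₗ affineEval F r))
      (r * Fintype.card F ^ 2) (r + 2) d := by
  refine isLinearCode_range _ (funLeft_comp_affineEval_injective hr ε) (card_of_equiv_affine ε)
    (by simp) ?_ ?_
  · rintro ⟨g, h⟩ hp
    rw [LinearMap.comp_apply, hammingNorm_funLeft, hd]
    by_cases hh : h = 0
    · subst hh
      have hg : g ≠ 0 := fun hg => hp (by rw [hg]; rfl)
      rw [hammingNorm_affineEval_of_eq_zero]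
      exact (min_le_right _ _).trans
        (Nat.le_mul_of_pos_right _ (hammingNorm_pos_iff.2 hg))
    · rw [hammingNorm_affineEval_of_ne_zero _ _ hh]
      exact min_le_left _ _
  · rcases min_choice (r * (Fintype.card F * (Fintype.card F - 1))) (Fintype.card F ^ 2)
      with h | h
    · refine ⟨(0, (1, 0)), fun h => ?_, ?_⟩
      · exact one_ne_zero (congrArg (fun p => p.2.1) h)
      · rw [LinearMap.comp_apply, hammingNorm_funLeft, hd, h]
        exact hammingNorm_affineEval_of_ne_zero _ _ fun h =>
          one_ne_zero (congrArg Prod.fst h)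
    · refine ⟨(Pi.single ⟨0, hr⟩ 1, 0), fun h => ?_, ?_⟩
      · have := congrFun (congrArg Prod.fst h) ⟨0, hr⟩
        simp at this
      · rw [LinearMap.comp_apply, hammingNorm_funLeft, hd, h, hammingNorm_affineEval_of_eq_zero]
        have : hammingNorm (Pi.single ⟨0, hr⟩ 1 : Fin r → F) = 1 := by
          rw [hammingNorm, Finset.card_eq_one]
          refine ⟨⟨0, hr⟩, ?_⟩
          ext i
          simp [Pi.single_apply]
        rw [this, mul_one]

end AffineTraceCode

/-! ### The two discriminant cases -/

section Corollary

variable {F K : Type*} [Field F] [Fintype F] [DecidableEq F] [Field K] [Fintype K]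
  [DecidableEq K] [Algebra F K]

theorem exists_equiv_of_not_isSquare (h2 : (2 : F) ≠ 0) (hm : Module.finrank F K = 4) {e : ℕ}
    (he : Odd e) {u v : F} (hv : v ≠ 0) (hδ : ¬ IsSquare (v ^ 2 - 4 * u)) :
    ∃ ε : definingSet₁ K e u v ≃ Fin 2 × F × F, traceCode F (definingSet₁ K e u v) =
      LinearMap.range ((LinearMap.funLeft F F ε) ∘ₗ affineEval F 2) := by
  obtain ⟨t, ht, hσt⟩ := exists_sq_eq_frobenius_eq_neg (K := K) h2 hm (Or.inr hδ)
  have h2K : (2 : K) ≠ 0 := by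
    rw [← map_ofNat (algebraMap F K) 2]
    exact (_root_.map_ne_zero _).2 h2
  have h4K : (4 : K) ≠ 0 := by
    rw [show (4 : K) = 2 * 2 by norm_num]
    exact mul_ne_zero h2K h2K
  have hvK : algebraMap F K v ≠ 0 := (_root_.map_ne_zero _).2 hv
  have ht0 : t ≠ 0 := by
    rintro rfl
    refine hδ ?_
    rw [zero_pow two_ne_zero, eq_comm, map_eq_zero] at ht
    rw [ht]
    exact IsSquare.zero
  refine exists_equiv_traceCode_of_cosets h2 hm
    ![(algebraMap F K v + t) / 4, (algebraMap F K v - t) / 4] ?_ ?_ _ fun x => ?_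
  · rw [LinearIndependent.pair_iff]
    intro α β h
    -- Frobenius swaps the two representatives, so adding and subtracting the conjugate relation
    -- isolates (α + β)v and (α - β)t.
    have hσ := congrArg (FiniteField.frobeniusAlgHom F K) h
    simp only [Algebra.smul_def, map_add, map_mul, map_div₀, map_sub, AlgHom.commutes, hσt,
      map_ofNat, map_zero] at h hσ
    field_simp at h hσ
    have hs : 2 * algebraMap F K v * algebraMap F K (α + β) = 0 := by
      rw [map_add]
      linear_combination h + hσ
    have hd : 2 * t * algebraMap F K (α - β) = 0 := by
      rw [map_sub]
      linear_combination h - hσ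
    have hs' := (mul_eq_zero.1 hs).resolve_left (mul_ne_zero h2K hvK)
    have hd' := (mul_eq_zero.1 hd).resolve_left (mul_ne_zero h2K ht0)
    rw [map_eq_zero] at hs' hd'
    constructor
    · refine (mul_eq_zero.1 ?_).resolve_left h2
      linear_combination hs' + hd'
    · refine (mul_eq_zero.1 ?_).resolve_left h2
      linear_combination hs' - hd'
  · intro i
    rw [mem_sqEigenspace, one_smul]
    refine (Fin.forall_fin_two (p := fun i => FiniteField.frobeniusAlgHom F K
      (FiniteField.frobeniusAlgHom F K (![(algebraMap F K v + t) / 4,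
        (algebraMap F K v - t) / 4] i)) = _)).2 ⟨?_, ?_⟩ i <;>
      simp only [Matrix.cons_val_zero, Matrix.cons_val_one, map_div₀, map_add, map_sub,
        AlgHom.commutes, hσt, map_neg, neg_neg, map_ofNat]
  · rw [mem_definingSet₁_iff h2 hm he hv ht hσt, Fin.exists_fin_two]
    rfl

theorem exists_equiv_of_eq_zero (h2 : (2 : F) ≠ 0) (hm : Module.finrank F K = 4) {e : ℕ}
    (he : Odd e) {u v : F} (hv : v ≠ 0) (hδ : v ^ 2 - 4 * u = 0) :
    ∃ ε : definingSet₁ K e u v ≃ Fin 1 × F × F, traceCode F (definingSet₁ K e u v) =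
      LinearMap.range ((LinearMap.funLeft F F ε) ∘ₗ affineEval F 1) := by
  have ht : (0 : K) ^ 2 = algebraMap F K (v ^ 2 - 4 * u) := by
    rw [hδ, map_zero, zero_pow two_ne_zero]
  have h2K : (2 : K) ≠ 0 := by
    rw [← map_ofNat (algebraMap F K) 2]
    exact (_root_.map_ne_zero _).2 h2
  have h4K : (4 : K) ≠ 0 := by
    rw [show (4 : K) = 2 * 2 by norm_num]
    exact mul_ne_zero h2K h2K
  refine exists_equiv_traceCode_of_cosets h2 hm (fun _ => algebraMap F K v / 4) ?_ ?_ _ fun x => ?_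
  · rw [linearIndependent_unique_iff]
    exact div_ne_zero ((_root_.map_ne_zero _).2 hv) h4K
  · intro i
    rw [mem_sqEigenspace, one_smul]
    simp only [map_div₀, AlgHom.commutes, map_ofNat]
  · rw [mem_definingSet₁_iff h2 hm he hv ht (by rw [map_zero, neg_zero]), add_zero, sub_zero,
      or_self, exists_const]

end Corollary

theorem odd_of_eps_four_eq_one {e : ℕ} (h : eps 4 e = 1) : Odd e := by
  have hg : Nat.gcd 4 e = 1 := by
    unfold eps at h
    split_ifs at h
    exact h
  rw [← Nat.coprime_two_left]
  exact Nat.Coprime.coprime_dvd_left (by norm_num : 2 ∣ 4) hg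

end FewWeightCodes

theorem corollary2 {p : ℕ} [Fact p.Prime] (hp : p ≠ 2)
    {F K : Type*} [Field F] [Fintype F] [DecidableEq F] [CharP F p]
    [Field K] [Fintype K] [DecidableEq K] [Algebra F K]
    (q : ℕ) (hq : Fintype.card F = q) (hm : Module.finrank F K = 4)
    (e : ℕ) (he : 0 < e) (heven : Even (4 / Nat.gcd 4 e)) (hε : FewWeightCodes.eps 4 e = 1)
    (u v : F) (hv : v ≠ 0) :
    (quadraticChar F (v ^ 2 - u * FewWeightCodes.residue F p 4) = -1 →
      FewWeightCodes.IsWeightCode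
          (FewWeightCodes.traceCode F (FewWeightCodes.definingSet₁ K e u v)) 3 ∧
        FewWeightCodes.IsLinearCode
          (FewWeightCodes.traceCode F (FewWeightCodes.definingSet₁ K e u v))
          (2 * q ^ 2) 4 (q ^ 2) ∧
        FewWeightCodes.weightEnumerator
            (FewWeightCodes.traceCode F (FewWeightCodes.definingSet₁ K e u v)) =
          1 + C (2 * ((q : ℤ) - 1)) * X ^ (q ^ 2)
            + C ((q : ℤ) ^ 4 - (q : ℤ) ^ 2) * X ^ (2 * q * (q - 1))
            + C (((q : ℤ) - 1) ^ 2) * X ^ (2 * q ^ 2)) ∧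
    (v ^ 2 - u * FewWeightCodes.residue F p 4 = 0 →
      FewWeightCodes.IsWeightCode
          (FewWeightCodes.traceCode F (FewWeightCodes.definingSet₁ K e u v)) 2 ∧
        FewWeightCodes.IsLinearCode
          (FewWeightCodes.traceCode F (FewWeightCodes.definingSet₁ K e u v))
          (q ^ 2) 3 (q ^ 2 - q) ∧
        FewWeightCodes.IsOptimalLinearCode
          (FewWeightCodes.traceCode F (FewWeightCodes.definingSet₁ K e u v))
          (q ^ 2) 3 (q ^ 2 - q) ∧
        FewWeightCodes.MeetsGriesmerBound F (q ^ 2) 3 (q ^ 2 - q) ∧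
        FewWeightCodes.weightEnumerator
            (FewWeightCodes.traceCode F (FewWeightCodes.definingSet₁ K e u v)) =
          1 + C ((q : ℤ) ^ 3 - (q : ℤ)) * X ^ ((q - 1) * q)
            + C ((q : ℤ) - 1) * X ^ (q ^ 2)) := by
  subst hq
  have he' : Odd e := FewWeightCodes.odd_of_eps_four_eq_one hε
  have h2 : (2 : F) ≠ 0 := Ring.two_ne_zero (by rwa [ringChar.eq F p])
  -- The residue of 4 casts to 4 in characteristic p, so the quantity tested is the discriminant v²
  -- - 4u.
  have h4 : FewWeightCodes.residue F p 4 = 4 := by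
    rw [FewWeightCodes.residue, ← CharP.cast_eq_mod]
    norm_num
  have hq : 2 < Fintype.card F := by
    have h := FiniteField.odd_card_of_char_ne_two (F := F) (by rwa [ringChar.eq F p])
    have := Fintype.one_lt_card (α := F)
    omega
  rw [h4, mul_comm u]
  generalize hQ : Fintype.card F = q at *
  have hq1 : 1 ≤ q := by omega
  have hqZ : (2 : ℤ) < q := by exact_mod_cast hq
  constructor
  · intro hδ
    obtain ⟨ε, hC⟩ := FewWeightCodes.exists_equiv_of_not_isSquare (K := K) h2 hm he' hv
      (quadraticChar_neg_one_iff_not_isSquare.1 hδ)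
    have hcard := FewWeightCodes.card_of_equiv_affine ε
    have henum := FewWeightCodes.weightEnumerator_affine two_pos ε
    have hlin := FewWeightCodes.isLinearCode_affine two_pos ε (d := q ^ 2) (by
      rw [hQ, min_eq_right]
      obtain ⟨a, rfl⟩ : ∃ a, q = a + 1 := ⟨q - 1, by omega⟩
      rw [Nat.add_sub_cancel]
      nlinarith)
    rw [hQ] at hcard henum hlin
    rw [← hC] at henum hlin
    have henum' : FewWeightCodes.weightEnumerator
        (FewWeightCodes.traceCode F (FewWeightCodes.definingSet₁ K e u v)) =
          1 + C (2 * ((q : ℤ) - 1)) * X ^ (q ^ 2)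
            + C ((q : ℤ) ^ 4 - (q : ℤ) ^ 2) * X ^ (2 * q * (q - 1))
            + C (((q : ℤ) - 1) ^ 2) * X ^ (2 * q ^ 2) := by
      -- Expanding (1 + (q - 1)X^(q²))² produces the terms of weight q² and 2q².
      rw [henum, mul_assoc 2 q (q - 1), mul_comm 2 (q ^ 2), pow_mul X (q ^ 2) 2]
      simp only [map_mul, map_sub, map_pow, map_natCast, map_one, map_ofNat]
      ring
    -- Strict only because q > 2; at q = 2 these two weights would coincide.
    have hlt1 : q ^ 2 < 2 * q * (q - 1) := by
      obtain ⟨a, rfl⟩ : ∃ a, q = a + 1 := ⟨q - 1, by omega⟩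
      rw [Nat.add_sub_cancel]
      nlinarith
    have hlt2 : 2 * q * (q - 1) < 2 * q ^ 2 := by
      rw [mul_assoc, sq]
      have : q * (q - 1) < q * q := Nat.mul_lt_mul_of_pos_left (by omega) (by omega)
      omega
    have hpos : 0 < q ^ 2 := by positivity
    refine ⟨?_, hlin, henum'⟩
    have := FewWeightCodes.isWeightCode_of_weightEnumerator _
      {q ^ 2, 2 * q * (q - 1), 2 * q ^ 2}
      (fun i => if i = q ^ 2 then 2 * ((q : ℤ) - 1) else
        if i = 2 * q ^ 2 then ((q : ℤ) - 1) ^ 2 else (q : ℤ) ^ 4 - (q : ℤ) ^ 2)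
      (by
        intro i hi
        rw [hcard, Finset.mem_Icc]
        simp only [Finset.mem_insert, Finset.mem_singleton] at hi
        omega)
      (by
        intro i _
        have h1 : 2 * ((q : ℤ) - 1) ≠ 0 := by linarith
        have h2 : ((q : ℤ) - 1) ^ 2 ≠ 0 := pow_ne_zero 2 (by linarith)
        have h3 : (q : ℤ) ^ 4 - (q : ℤ) ^ 2 ≠ 0 := by
          rw [show (q : ℤ) ^ 4 - (q : ℤ) ^ 2 = (q : ℤ) ^ 2 * ((q - 1) * (q + 1)) by ring]
          exact mul_ne_zero (pow_ne_zero 2 (by linarith))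
            (mul_ne_zero (by linarith) (by linarith))
        split_ifs <;> assumption)
      (by
        rw [Finset.sum_insert (by simp only [Finset.mem_insert, Finset.mem_singleton]; omega),
          Finset.sum_pair hlt2.ne, if_pos rfl, if_neg hlt1.ne', if_neg hlt2.ne,
          if_neg (hlt1.trans hlt2).ne', if_pos rfl, henum']
        ring)
    rwa [Finset.card_insert_of_notMem
      (by simp only [Finset.mem_insert, Finset.mem_singleton]; omega),
      Finset.card_pair hlt2.ne] at this
  · intro hδ
    obtain ⟨ε, hC⟩ := FewWeightCodes.exists_equiv_of_eq_zero (K := K) h2 hm he' hv hδ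
    have hcard := FewWeightCodes.card_of_equiv_affine ε
    have henum := FewWeightCodes.weightEnumerator_affine one_pos ε
    have hsub : q ^ 2 - q = q * (q - 1) := by rw [Nat.mul_sub, mul_one, sq]
    have hlt : (q - 1) * q < q ^ 2 := by
      rw [sq]
      exact Nat.mul_lt_mul_of_pos_right (by omega) (by omega)
    have hpos : 0 < (q - 1) * q := Nat.mul_pos (by omega) (by omega)
    have hlin := FewWeightCodes.isLinearCode_affine one_pos ε (d := q ^ 2 - q) (by
      rw [hQ, one_mul, ← hsub, min_eq_left (Nat.sub_le _ _)])
    rw [hQ, one_mul] at hcard hlin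
    rw [hQ] at henum
    rw [← hC] at henum hlin
    have henum' : FewWeightCodes.weightEnumerator
        (FewWeightCodes.traceCode F (FewWeightCodes.definingSet₁ K e u v)) =
          1 + C ((q : ℤ) ^ 3 - (q : ℤ)) * X ^ ((q - 1) * q)
            + C ((q : ℤ) - 1) * X ^ (q ^ 2) := by
      rw [henum, one_mul, mul_comm (q - 1) q]
      simp only [map_sub, map_pow, map_natCast, map_one]
      ring
    refine ⟨?_, hlin, ⟨hlin, fun n' k' d' C' hC' hn hk hd => ?_⟩, ?_, henum'⟩
    · have := FewWeightCodes.isWeightCode_of_weightEnumerator _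
        {(q - 1) * q, q ^ 2}
        (fun i => if i = q ^ 2 then (q : ℤ) - 1 else (q : ℤ) ^ 3 - (q : ℤ))
        (by
          intro i hi
          rw [hcard, Finset.mem_Icc]
          simp only [Finset.mem_insert, Finset.mem_singleton] at hi
          omega)
        (by
          intro i _
          have h1 : (q : ℤ) - 1 ≠ 0 := by linarith
          have h3 : (q : ℤ) ^ 3 - (q : ℤ) ≠ 0 := by
            rw [show (q : ℤ) ^ 3 - (q : ℤ) = (q : ℤ) * ((q - 1) * (q + 1)) by ring]
            exact mul_ne_zero (by linarith) (mul_ne_zero (by linarith) (by linarith))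
          split_ifs <;> assumption)
        (by rw [Finset.sum_pair hlt.ne, if_neg hlt.ne, if_pos rfl, henum', add_assoc])
      rwa [Finset.card_pair hlt.ne] at this
    · have h := FewWeightCodes.parameters_eq_of_isLinearCode C' hC'
      rw [hQ] at h
      exact h hn hk hd
    · have h := FewWeightCodes.meetsGriesmerBound_sq F
      rwa [hQ] at h
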